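/- **Proposition 2.2.** Let $0<\alpha<2$, $C_1>0$, $C_2>0$, $\gamma\in\mathbb R$, and let $X_t$ $(t\ge 0)$ be the $\alpha$-stable Lévy process on $\mathbb R$, $X_0=0$, given by $$E\,e^{izX_t}=e^{-t\lambda(z)},\qquad \lambda(z)=-i\gamma z-\int_{-\infty}^{\infty}\bigl(e^{ixz}-1-ixz\,1_{|x|\le1}\bigr)\nu'(x)\,dx,$$ $$\nu'(y)=|y|^{-\alpha-1}\bigl(C_1 1_{y<0}+C_2 1_{y>0}\bigr).$$ Let $L$ be the infinitesimal generator of the semigroup $P_tf(x)=E f(x+X_t)$ on the space $C_0$ of real continuous functions on $\mathbb R$ vanishing at infinity, with the supremum norm. Then every $C^2$ function $f$ with compact support lies in the domain of $L$, and $$Lf=\frac{d}{dx}\,S\,\frac{d}{dx}f,\qquad Sg(x)=\int_{-\infty}^{\infty}k(y-x)g(y)\,dy,$$ where the integrals defining $Sf'$ converge absolutely, $Sf'$ is everywhere differentiable, and $k$ is the following function, which is integrable on $[-M,M]$ for every $0<M<\infty$. Put $p_0(y)=-\tfrac12\,\mathrm{sign}(y)$ (so that $f'=\frac{d}{dx}\int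 p_0(y-x)f'(y)\,dy$) and, for $y\neq0$, $$k_0(y)=\frac{1}{\alpha(\alpha-1)}|y|^{1-\alpha}\bigl(C_1 1_{y<0}+C_2 1_{y>0}\bigr)\ \ (\alpha\ne1),\qquad k_0(y)=-\log|y|\,\bigl(C_1 1_{y<0}+C_2 1_{y>0}\bigr)\ \ (\alpha=1).$$ 1. If $1\le\alpha<2$, then $$k(y)=k_0(y)+(\gamma-\Gamma)\,p_0(y),\qquad \Gamma=k_0(-1)+k_0'(-1)-k_0(1)+k_0'(1).$$ 2. If $0<\alpha<1$, then $$k(y)=k_0(y)+\gamma_0\,p_0(y),\qquad \gamma_0=\gamma-\int_{|y|\le1}y\,\nu'(y)\,dy,$$ that is, $\gamma_0$ is the drift of the process. -/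

import Mathlib

open MeasureTheory ProbabilityTheory Filter Topology
open scoped NNReal ZeroAtInfty

noncomputable section

/-- A real Lévy process started at `0`: independent and stationary increments, continuous in
probability. (Regularity of the paths is not required.) -/
structure IsLevyProcess {Ω : Type*} [MeasurableSpace Ω] (P : Measure Ω) (X : ℝ≥0 → Ω → ℝ) :
    Prop where
  aemeasurable : ∀ t, AEMeasurable (X t) P
  start_zero : ∀ᵐ ω ∂P, X 0 ω = 0
  indep_increments : HasIndepIncrements X P
  stationary_increments :
    ∀ s h : ℝ≥0, IdentDistrib (fun ω => X (s + h) ω - X s ω) (X h) P P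
  continuous_in_probability : ∀ t, TendstoInMeasure P X (𝓝 t) (X t)

/-- The exponent `λ(z) = A z² / 2 - i γ z - ∫ (e^{ixz} - 1 - i x z 1_{|x| ≤ 1}) dν(x)`. -/
def levyExponent (A γ : ℝ) (ν : Measure ℝ) (z : ℝ) : ℂ :=
  (1 / 2 : ℂ) * A * (z : ℂ) ^ 2 - Complex.I * γ * z
    - ∫ x, (Complex.exp (Complex.I * x * z) - 1
        - (Set.Icc (-1 : ℝ) 1).indicator (fun x : ℝ => Complex.I * x * z) x) ∂ν

/-- `E exp(i z X_t) = exp(-t λ(z))` for the Lévy triplet `(A, γ, ν)`. -/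
def HasLevyTriplet {Ω : Type*} [MeasurableSpace Ω] (P : Measure Ω) (X : ℝ≥0 → Ω → ℝ)
    (A γ : ℝ) (ν : Measure ℝ) : Prop :=
  ∀ (t : ℝ≥0) (z : ℝ),
    ∫ ω, Complex.exp (Complex.I * z * X t ω) ∂P = Complex.exp (-(t : ℂ) * levyExponent A γ ν z)

/-- The density `|y|^{-α-1} (C₁ 1_{y<0} + C₂ 1_{y>0})`. -/
def stableDensity (α C₁ C₂ y : ℝ) : ℝ :=
  |y| ^ (-α - 1) * ((if y < 0 then C₁ else 0) + (if 0 < y then C₂ else 0))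

/-- The Lévy measure of the `α`-stable process. -/
def stableLevyMeasure (α C₁ C₂ : ℝ) : Measure ℝ :=
  (volume : Measure ℝ).withDensity (fun y => ENNReal.ofReal (stableDensity α C₁ C₂ y))

/-- `X` is an `α`-stable Lévy process: it has no Gaussian part, and its Lévy measure
has the density `stableDensity α C₁ C₂`. -/
structure IsStableProcess {Ω : Type*} [MeasurableSpace Ω] (P : Measure Ω) (X : ℝ≥0 → Ω → ℝ)
    (α γ C₁ C₂ : ℝ) : Prop where
  isLevyProcess : IsLevyProcess P X
  hasLevyTriplet : HasLevyTriplet P X 0 γ (stableLevyMeasure α C₁ C₂)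

/-- The transition probability `P_t(x, ·)`: the law at time `t` of the process started at `x`. -/
def transitionMeasure {Ω : Type*} [MeasurableSpace Ω] (P : Measure Ω) (X : ℝ≥0 → Ω → ℝ)
    (t : ℝ≥0) (x : ℝ) : Measure ℝ :=
  P.map (fun ω => x + X t ω)

/-- The transition operator `P_t f (x) = ∫ P_t(x, dy) f(y)`. -/
def transitionOp {Ω : Type*} [MeasurableSpace Ω] (P : Measure Ω) (X : ℝ≥0 → Ω → ℝ)
    (t : ℝ≥0) (f : ℝ → ℝ) (x : ℝ) : ℝ :=
  ∫ y, f y ∂(transitionMeasure P X t x)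

/-- `f` lies in the domain of the infinitesimal generator `L` of the semigroup `P_t` on `C₀(ℝ)`,
and `L f = g`: the quotients `(P_t f - f) / t` converge to `g` in the supremum norm
as `t` decreases to `0`. -/
def IsGeneratorValue {Ω : Type*} [MeasurableSpace Ω] (P : Measure Ω) (X : ℝ≥0 → Ω → ℝ)
    (f g : C₀(ℝ, ℝ)) : Prop :=
  TendstoUniformly (fun (t : ℝ≥0) (x : ℝ) => (transitionOp P X t f x - f x) / (t : ℝ)) g
    (𝓝[>] (0 : ℝ≥0))

/-- The operator `S f (x) = A f(x) / 2 + ∫ k(y - x) f(y) dy`. -/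
def convolutionOp (A : ℝ) (k : ℝ → ℝ) (f : ℝ → ℝ) (x : ℝ) : ℝ :=
  1 / 2 * A * f x + ∫ y, k (y - x) * f y

/-- The generator `L` of `X` has the convolution representation `L = (d/dx) S (d/dx)`, where
`S` is the operator with parameters `A` and `k`: the kernel `k` is integrable on
every `[-M, M]`, and every `C²` function `f` with compact support lies in the domain of `L`,
the integrals that define `S f'` converge absolutely, and `S f'` is everywhere differentiable
with derivative `L f`. -/
def HasConvolutionRepresentation {Ω : Type*} [MeasurableSpace Ω] (P : Measure Ω)
    (X : ℝ≥0 → Ω → ℝ) (A : ℝ) (k : ℝ → ℝ) : Prop :=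
  (∀ M : ℝ, 0 < M → IntegrableOn k (Set.Icc (-M) M)) ∧
  ∀ f : C₀(ℝ, ℝ), ContDiff ℝ 2 f → HasCompactSupport f →
    (∀ x : ℝ, Integrable (fun y => k (y - x) * deriv f y)) ∧
    ∃ g : C₀(ℝ, ℝ), IsGeneratorValue P X f g ∧
      ∀ x : ℝ, HasDerivAt (convolutionOp A k (deriv f)) (g x) x

/-- The explicit function `k₀`: logarithmic for `α = 1`, a power otherwise. -/
def stableK0 (α C₁ C₂ y : ℝ) : ℝ :=
  (if α = 1 then -Real.log |y| else 1 / (α * (α - 1)) * |y| ^ (1 - α)) *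
    ((if y < 0 then C₁ else 0) + (if 0 < y then C₂ else 0))

/-- The kernel of `d/dx`: `f' = (d/dx) ∫ p₀(y - x) f'(y) dy`. -/
def p0 (x : ℝ) : ℝ := -(1 / 2) * Real.sign x

/-- The constant `Γ = k₀(-1) + k₀'(-1) - k₀(1) + k₀'(1)`. -/
def gammaConst (k₀ : ℝ → ℝ) : ℝ :=
  k₀ (-1) + deriv k₀ (-1) - k₀ 1 + deriv k₀ 1

/-- The drift `γ₀ = γ - ∫_{|y| ≤ 1} y ν'(y) dy`. -/
def stableDrift (α γ C₁ C₂ : ℝ) : ℝ :=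
  γ - ∫ y in Set.Icc (-1 : ℝ) 1, y * stableDensity α C₁ C₂ y

end

/-!
Write `λ` for the exponent of the process, `ν` for its Lévy measure, and
`G f (x) = γ f'(x) + ∫ (f (x + y) - f x - y f'(x) 1_{|y| ≤ 1}) dν(y)` (`levyOperator`). The proof has
two independent halves: compactly supported `C²` functions lie in the domain of the generator, which
acts on them as `G`, and `G f (x) = ∫ k(u) f''(x + u) du`, which is the derivative of `S f'`.

*The generator.* For compactly supported `C²` functions `f` the compensated increments are bounded
by a multiple of `min 1 y²` and are jointly integrable in `(x, y)`, so that `G f` is integrable and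
lies in `C₀`, and Fubini gives `(G f)^ = -λ f̂` (`fourierIntegralReal_levyOperator`). As
`(P_t g)^ = exp (-t λ) ĝ`, the continuous integrable functions `P_t f - f` and `∫₀ᵗ P_s (G f) ds`
have the same Fourier transform, hence are equal (`transitionOp_sub_eq_integral`). No smoothing
of `f` is needed, since Fourier inversion is applied only to their difference. Continuity in
probability makes `s ↦ P_s (G f)` continuous at `0` in the supremum norm
(`tendstoUniformly_transitionOp`); averaging over `[0, t]` shows that `(P_t f - f) / t` converges
uniformly to `G f` (`isGeneratorValue_levyOperatorC0`).

*The kernel.* Each half of `k₀` is a constant times a function whose second derivative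
is `u ^ (-α - 1)`, so two integrations by parts on `(0, 1]` and on `(1, ∞)` turn
`∫ k₀(u) f''(x + u) du` into the compensated integral of the increments plus `Γ f'(x)`, where
`Γ f'(x)` collects the boundary terms at `±1`
(`setIntegral_stableProfile_mul_deriv_deriv`, `integral_stableK0_mul_deriv_deriv`). The multiple
`γ - Γ` of `p₀` corrects the first-order term. This works for every `0 < α < 2`; for `α < 1` one has
`Γ = ∫_{|y| ≤ 1} y ν'(y) dy` (`gammaConst_eq_integral`), so `γ - Γ` is the drift.
-/

/-! ### The transition operators -/

section TransitionOp

variable {Ω : Type*} [MeasurableSpace Ω] {P : Measure Ω} {X : ℝ≥0 → Ω → ℝ}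

lemma transitionOp_eq_integral (hX : ∀ t, AEMeasurable (X t) P) {g : ℝ → ℝ} (hg : Continuous g)
    (t : ℝ≥0) (x : ℝ) : transitionOp P X t g x = ∫ ω, g (x + X t ω) ∂P := by
  rw [transitionOp, transitionMeasure,
    integral_map ((hX t).const_add x) hg.measurable.aestronglyMeasurable]

lemma transitionOp_eq_integral_map (hX : ∀ t, AEMeasurable (X t) P) {g : ℝ → ℝ}
    (hg : Continuous g) (t : ℝ≥0) (x : ℝ) :
    transitionOp P X t g x = ∫ y, g (x + y) ∂(P.map (X t)) := by
  rw [transitionOp_eq_integral hX hg, integral_map (f := fun y => g (x + y)) (hX t)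
    (hg.comp (continuous_const.add continuous_id)).measurable.aestronglyMeasurable]

lemma ZeroAtInftyContinuousMap.exists_norm_le (g : C₀(ℝ, ℝ)) : ∃ M, 0 < M ∧ ∀ x, ‖g x‖ ≤ M :=
  ⟨‖g.toBCF‖ + 1, by positivity, fun x => (g.toBCF.norm_coe_le_norm x).trans (by simp)⟩

lemma integrable_zeroAtInfty_comp [IsProbabilityMeasure P] (hX : ∀ t, AEMeasurable (X t) P)
    (g : C₀(ℝ, ℝ)) (t : ℝ≥0) (x : ℝ) : Integrable (fun ω => g (x + X t ω)) P := by
  obtain ⟨M, -, hM⟩ := ZeroAtInftyContinuousMap.exists_norm_le g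
  exact Integrable.of_bound ((map_continuous g).measurable.comp_aemeasurable
    ((hX t).const_add x)).aestronglyMeasurable M (.of_forall fun ω => hM _)

/-- Continuity in probability makes `t ↦ P_t g` continuous in the supremum norm: `g` is uniformly
continuous, so `|g (x + X_s) - g (x + X_t)|` is small, uniformly in `x`, outside an event of small
probability. -/
lemma tendstoUniformly_transitionOp [IsProbabilityMeasure P]
    (hX : ∀ t, AEMeasurable (X t) P) {t : ℝ≥0}
    (ht : TendstoInMeasure P X (𝓝 t) (X t)) (g : C₀(ℝ, ℝ)) :
    TendstoUniformly (fun (s : ℝ≥0) (x : ℝ) => transitionOp P X s g x) (transitionOp P X t g)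
      (𝓝 t) := by
  obtain ⟨M, hM0, hM⟩ := ZeroAtInftyContinuousMap.exists_norm_le g
  rw [Metric.tendstoUniformly_iff]
  intro ε hε
  obtain ⟨δ, hδ, hgδ⟩ := Metric.uniformContinuous_iff.1
    (ZeroAtInftyContinuousMap.uniformContinuous g) (ε / 2) (half_pos hε)
  rw [tendstoInMeasure_iff_measureReal_norm] at ht
  have hlim := (ht δ hδ).eventually (gt_mem_nhds (show (0 : ℝ) < ε / (4 * M) by positivity))
  filter_upwards [hlim] with s hs x
  set A : Set Ω := {ω | δ ≤ ‖X s ω - X t ω‖} with hA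
  have hAm : NullMeasurableSet A P :=
    nullMeasurableSet_le aemeasurable_const ((hX s).sub (hX t)).norm
  have hind : Integrable (A.indicator fun _ => 2 * M) P :=
    (integrable_const _).indicator₀ hAm
  have hpt : ∀ ω, ‖g (x + X t ω) - g (x + X s ω)‖ ≤ ε / 2 + A.indicator (fun _ => 2 * M) ω := by
    intro ω
    by_cases hω : ω ∈ A
    · rw [Set.indicator_of_mem hω]
      linarith [norm_sub_le (g (x + X t ω)) (g (x + X s ω)), hM (x + X t ω), hM (x + X s ω)]
    · rw [Set.indicator_of_notMem hω, add_zero, ← dist_eq_norm]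
      refine (hgδ ?_).le
      have : ‖X s ω - X t ω‖ < δ := not_le.1 hω
      rwa [dist_add_left, dist_comm, dist_eq_norm]
  rw [dist_eq_norm, transitionOp_eq_integral hX (map_continuous g), transitionOp_eq_integral hX
    (map_continuous g), ← integral_sub (integrable_zeroAtInfty_comp hX g t x)
    (integrable_zeroAtInfty_comp hX g s x)]
  calc _ ≤ ∫ ω, (ε / 2 + A.indicator (fun _ => 2 * M) ω) ∂P :=
        norm_integral_le_of_norm_le ((integrable_const _).add hind) (.of_forall hpt)
    _ = ε / 2 + P.real A * (2 * M) := by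
        rw [integral_add (integrable_const _) hind, integral_indicator₀ hAm]
        simp
    _ < ε / 2 + ε / (4 * M) * (2 * M) := by gcongr
    _ = ε := by field_simp; ring

lemma continuous_transitionOp_uncurry [IsProbabilityMeasure P]
    (hX : ∀ t, AEMeasurable (X t) P)
    (hc : ∀ t, TendstoInMeasure P X (𝓝 t) (X t)) (g : C₀(ℝ, ℝ)) :
    Continuous fun p : ℝ≥0 × ℝ => transitionOp P X p.1 g p.2 := by
  have hx : ∀ t, Continuous (transitionOp P X t g) := by
    intro t
    obtain ⟨M, -, hM⟩ := ZeroAtInftyContinuousMap.exists_norm_le g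
    simp_rw [funext (transitionOp_eq_integral hX (map_continuous g) t)]
    refine continuous_of_dominated (bound := fun _ => M)
      (fun x => (integrable_zeroAtInfty_comp hX g t x).aestronglyMeasurable)
      (fun x => .of_forall fun ω => hM _) (integrable_const _) (.of_forall fun ω => ?_)
    exact (map_continuous g).comp (continuous_id.add continuous_const)
  rw [continuous_iff_continuousAt]
  rintro ⟨t, x⟩
  have h1 : TendstoUniformly (fun (p : ℝ≥0 × ℝ) (x : ℝ) => transitionOp P X p.1 g x)
      (transitionOp P X t g) (𝓝 (t, x)) := fun u hu =>
    (continuous_fst.tendsto (t, x)).eventually (tendstoUniformly_transitionOp hX (hc t) g u hu)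
  exact h1.tendsto_comp (hx t).continuousAt (continuous_snd.tendsto (t, x))

end TransitionOp

/-! ### The integro-differential operator of a Lévy triplet without Gaussian part -/

/-- The compensated increment `f (x + y) - f x - y f'(x) 1_{|y| ≤ 1}`. -/
noncomputable def compensatedIncrement (f : ℝ → ℝ) (x y : ℝ) : ℝ :=
  f (x + y) - f x - (Set.Icc (-1 : ℝ) 1).indicator (fun y => y) y * deriv f x

/-- The operator `γ f'(x) + ∫ (f (x + y) - f x - y f'(x) 1_{|y| ≤ 1}) dν(y)`, for a drift `γ` and
a Lévy measure `ν`. -/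
noncomputable def levyOperator (γ : ℝ) (ν : Measure ℝ) (f : ℝ → ℝ) (x : ℝ) : ℝ :=
  γ * deriv f x + ∫ y, compensatedIncrement f x y ∂ν

section LevyOperator

variable {f : ℝ → ℝ}

lemma ContDiff.continuous_deriv_deriv (hf : ContDiff ℝ 2 f) : Continuous (deriv (deriv f)) :=
  (hf.deriv' (n := 1)).continuous_deriv le_rfl

lemma ContDiff.hasDerivAt_deriv (hf : ContDiff ℝ 2 f) (x : ℝ) :
    HasDerivAt (deriv f) (deriv (deriv f) x) x :=
  ((hf.deriv' (n := 1)).differentiable one_ne_zero x).hasDerivAt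

lemma ContDiff.hasDerivAt_self (hf : ContDiff ℝ 2 f) (x : ℝ) : HasDerivAt f (deriv f x) x :=
  (hf.differentiable two_ne_zero x).hasDerivAt

lemma abs_sub_sub_mul_deriv_le (hf : ContDiff ℝ 2 f) {M : ℝ}
    (hM : ∀ x, ‖deriv (deriv f) x‖ ≤ M) (x y : ℝ) :
    ‖f (x + y) - f x - y * deriv f x‖ ≤ M * y ^ 2 := by
  have hM0 : 0 ≤ M := (norm_nonneg _).trans (hM 0)
  have hd : ∀ s : ℝ, ‖deriv f (x + s) - deriv f x‖ ≤ M * ‖s‖ := by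
    intro s
    have := Convex.norm_image_sub_le_of_norm_deriv_le (f := deriv f) (x := x) (y := x + s)
      (fun u _ => (hf.hasDerivAt_deriv u).differentiableAt) (fun u _ => hM u) convex_univ
      (Set.mem_univ _) (Set.mem_univ _)
    simpa using this
  have h := Convex.norm_image_sub_le_of_norm_hasDerivWithin_le (s := Set.uIcc 0 y) (x := 0)
    (y := y) (C := M * ‖y‖) (f := fun s => f (x + s) - s * deriv f x)
    (f' := fun s => deriv f (x + s) - deriv f x) (fun s _ => ?_) (fun s hs => ?_)
    (convex_uIcc 0 y) Set.left_mem_uIcc Set.right_mem_uIcc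
  · have e : f (x + y) - y * deriv f x - (f (x + 0) - 0 * deriv f x)
        = f (x + y) - f x - y * deriv f x := by rw [add_zero]; ring
    rw [e] at h
    refine h.trans_eq ?_
    rw [sub_zero, mul_assoc, Real.norm_eq_abs, abs_mul_abs_self]
    ring
  · have h1 : HasDerivAt (fun s => f (x + s)) (deriv f (x + s)) s :=
      (hf.hasDerivAt_self (x + s)).comp_const_add x s
    simpa using (h1.fun_sub ((hasDerivAt_id s).mul_const (deriv f x))).hasDerivWithinAt
  · refine (hd s).trans (mul_le_mul_of_nonneg_left ?_ hM0)
    simpa using Set.abs_sub_left_of_mem_uIcc hs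

/-- The compensated increments of a compactly supported `C²` function are bounded by a multiple of
`min 1 y²`, uniformly in `x`. -/
lemma exists_compensatedIncrement_bound (hf : ContDiff ℝ 2 f) (hc : HasCompactSupport f) :
    ∃ C, 0 ≤ C ∧ ∀ x y, ‖compensatedIncrement f x y‖ ≤ C * min 1 (y ^ 2) := by
  obtain ⟨A, hA⟩ := hc.exists_bound_of_continuous hf.continuous
  obtain ⟨M, hM⟩ := hc.deriv.deriv.exists_bound_of_continuous hf.continuous_deriv_deriv
  have hA0 : 0 ≤ A := (norm_nonneg _).trans (hA 0)
  have hM0 : 0 ≤ M := (norm_nonneg _).trans (hM 0)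
  refine ⟨2 * A + M, by positivity, fun x y => ?_⟩
  rw [compensatedIncrement]
  by_cases hy : y ∈ Set.Icc (-1 : ℝ) 1
  · rw [Set.indicator_of_mem hy, min_eq_right (by nlinarith [hy.1, hy.2])]
    nlinarith [abs_sub_sub_mul_deriv_le hf hM x y, mul_nonneg hA0 (sq_nonneg y)]
  · rw [Set.indicator_of_notMem hy, zero_mul, sub_zero, min_eq_left, mul_one]
    · linarith [norm_sub_le (f (x + y)) (f x), hA (x + y), hA x]
    · by_contra! h
      exact hy (abs_le.1 ((sq_lt_one_iff_abs_lt_one y).1 h).le)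

lemma measurable_compensatedIncrement (hf : ContDiff ℝ 2 f) :
    Measurable fun p : ℝ × ℝ => compensatedIncrement f p.1 p.2 := by
  have h1 : Measurable fun p : ℝ × ℝ => f (p.1 + p.2) :=
    (hf.continuous.comp continuous_add).measurable
  have h2 : Measurable ((Set.Icc (-1 : ℝ) 1).indicator fun y => y) :=
    measurable_id.indicator measurableSet_Icc
  exact (h1.sub (hf.continuous.measurable.comp measurable_fst)).sub
    ((h2.comp measurable_snd).mul
      ((hf.continuous_deriv (by norm_num)).measurable.comp measurable_fst))

lemma tendsto_compensatedIncrement (hf : ContDiff ℝ 2 f) {x₀ : ℝ} (y : ℝ) :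
    Tendsto (fun x => compensatedIncrement f x y) (𝓝 x₀) (𝓝 (compensatedIncrement f x₀ y)) := by
  have hd : Continuous (deriv f) := hf.continuous_deriv (by norm_num)
  have hf0 := hf.continuous
  have : Continuous fun x => compensatedIncrement f x y := by
    unfold compensatedIncrement
    fun_prop
  exact this.tendsto x₀

lemma tendsto_compensatedIncrement_cocompact (hc : HasCompactSupport f) (y : ℝ) :
    Tendsto (fun x => compensatedIncrement f x y) (cocompact ℝ) (𝓝 0) := by
  have h1 : Tendsto f (cocompact ℝ) (𝓝 0) := hc.is_zero_at_infty
  have h2 : Tendsto (deriv f) (cocompact ℝ) (𝓝 0) := hc.deriv.is_zero_at_infty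
  have h3 : Tendsto (fun x => f (x + y)) (cocompact ℝ) (𝓝 0) :=
    h1.comp (Homeomorph.addRight y).isClosedEmbedding.tendsto_cocompact
  simpa [compensatedIncrement] using (h3.sub h1).sub (h2.const_mul ((Set.Icc (-1 : ℝ) 1).indicator (fun y => y) y))

variable {ν : Measure ℝ}

lemma integrable_compensatedIncrement (hf : ContDiff ℝ 2 f) (hc : HasCompactSupport f)
    (hν : Integrable (fun y => min 1 (y ^ 2)) ν) (x : ℝ) :
    Integrable (compensatedIncrement f x) ν := by
  obtain ⟨C, -, hC⟩ := exists_compensatedIncrement_bound hf hc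
  exact (hν.const_mul C).mono'
    ((measurable_compensatedIncrement hf).comp measurable_prodMk_left).aestronglyMeasurable
    (.of_forall (hC x))

lemma tendsto_integral_compensatedIncrement (hf : ContDiff ℝ 2 f) (hc : HasCompactSupport f)
    (hν : Integrable (fun y => min 1 (y ^ 2)) ν) {l : Filter ℝ} [l.IsCountablyGenerated]
    {F : ℝ → ℝ} (h : ∀ y, Tendsto (fun x => compensatedIncrement f x y) l (𝓝 (F y))) :
    Tendsto (fun x => ∫ y, compensatedIncrement f x y ∂ν) l (𝓝 (∫ y, F y ∂ν)) := by
  obtain ⟨C, -, hC⟩ := exists_compensatedIncrement_bound hf hc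
  exact tendsto_integral_filter_of_dominated_convergence _
    (.of_forall fun x => (integrable_compensatedIncrement hf hc hν x).aestronglyMeasurable)
    (.of_forall fun x => .of_forall (hC x)) (hν.const_mul C) (.of_forall h)

/-- The image of a compactly supported `C²` function under `levyOperator`, as an element
of `C₀(ℝ)`. -/
noncomputable def levyOperatorC0 (γ : ℝ) (hf : ContDiff ℝ 2 f) (hc : HasCompactSupport f)
    (hν : Integrable (fun y => min 1 (y ^ 2)) ν) : C₀(ℝ, ℝ) where
  toFun := levyOperator γ ν f
  continuous_toFun := by
    refine ((hf.continuous_deriv (by norm_num)).const_mul γ).add ?_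
    exact continuous_iff_continuousAt.2 fun x =>
      tendsto_integral_compensatedIncrement hf hc hν (tendsto_compensatedIncrement hf)
  zero_at_infty' := by
    have h2 : Tendsto (deriv f) (cocompact ℝ) (𝓝 0) := hc.deriv.is_zero_at_infty
    have : (cocompact ℝ).IsCountablyGenerated := by
      rw [cocompact_eq_atBot_atTop]
      infer_instance
    have h := (h2.const_mul γ).add (tendsto_integral_compensatedIncrement hf hc hν
      (tendsto_compensatedIncrement_cocompact hc))
    rw [integral_zero, mul_zero, add_zero] at h
    exact h

/-- For `|y| ≤ 1` the compensated increment vanishes unless `x` is within distance `1` of the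
support of `f`; for `|y| > 1` it is dominated by `|f (x + y)| + |f x|`. Hence it is integrable in
both variables jointly. -/
lemma integrable_compensatedIncrement_prod [SFinite ν] (hf : ContDiff ℝ 2 f)
    (hc : HasCompactSupport f) (hν : Integrable (fun y => min 1 (y ^ 2)) ν) :
    Integrable (fun p : ℝ × ℝ => compensatedIncrement f p.1 p.2)
      ((volume : Measure ℝ).prod ν) := by
  obtain ⟨C, hC0, hC⟩ := exists_compensatedIncrement_bound hf hc
  obtain ⟨R, hR⟩ := hc.isCompact.isBounded.subset_closedBall 0
  have hz : ∀ x, R < |x| → f x = 0 ∧ deriv f x = 0 := by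
    intro x hx
    have hx' : x ∉ tsupport f := fun h => by
      have := hR h
      rw [mem_closedBall_zero_iff, Real.norm_eq_abs] at this
      linarith
    exact ⟨image_eq_zero_of_notMem_tsupport hx',
      image_eq_zero_of_notMem_tsupport fun h => hx' (tsupport_deriv_subset h)⟩
  have hfi : Integrable (fun x => ‖f x‖) :=
    (hf.continuous.integrable_of_hasCompactSupport hc).norm
  have hI : Integrable ((Set.Icc (-(R + 1)) (R + 1)).indicator fun _ => C) :=
    (integrable_indicator_iff measurableSet_Icc).2 (integrableOn_const (by simp))
  have b1 := hI.mul_prod hν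
  have b3 := hfi.mul_prod hν
  have b2 : Integrable (fun p : ℝ × ℝ => ‖f (p.1 + p.2)‖ * min 1 (p.2 ^ 2))
      ((volume : Measure ℝ).prod ν) :=
    (measurePreserving_add_prod (volume : Measure ℝ) ν).integrable_comp_of_integrable b3
  refine ((b1.add b2).add b3).mono' (measurable_compensatedIncrement hf).aestronglyMeasurable
    (.of_forall ?_)
  rintro ⟨x, y⟩
  simp only [Pi.add_apply]
  by_cases hx : |x| ≤ R + 1
  · rw [Set.indicator_of_mem (show x ∈ Set.Icc _ _ from abs_le.1 hx)]
    have h0 : 0 ≤ min 1 (y ^ 2) := by positivity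
    linarith [hC x y, mul_nonneg (norm_nonneg (f (x + y))) h0, mul_nonneg (norm_nonneg (f x)) h0]
  · rw [Set.indicator_of_notMem (show x ∉ Set.Icc _ _ from fun h => hx (abs_le.2 h)), zero_mul, zero_add,
      compensatedIncrement, (hz x (by linarith)).1, (hz x (by linarith)).2]
    push Not at hx
    rw [mul_zero, sub_zero, sub_zero, norm_zero, zero_mul, add_zero]
    by_cases hy : |y| ≤ 1
    · rw [(hz (x + y) (by linarith [abs_sub_abs_le_abs_add x y])).1]
      simp
    · rw [min_eq_left, mul_one]
      nlinarith [sq_abs y]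

end LevyOperator

/-! ### Fourier transforms -/

section Fourier

/-- The Fourier integral `∫ e^{-izx} f x dx` of a real function. -/
noncomputable def fourierIntegralReal (f : ℝ → ℝ) (z : ℝ) : ℂ :=
  ∫ x : ℝ, Complex.exp (-(Complex.I * z * x)) * (f x : ℂ)

lemma norm_exp_neg_I_mul (z x : ℝ) : ‖Complex.exp (-(Complex.I * z * x))‖ = 1 := by
  rw [Complex.norm_exp]
  simp

lemma continuous_exp_neg_I_mul (z : ℝ) :
    Continuous fun x : ℝ => Complex.exp (-(Complex.I * z * x)) := by
  fun_prop

/-- Multiplication by a function `e : α → ℂ` of modulus one preserves integrability. -/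
lemma integrable_mul_ofReal_of_norm_eq_one {α : Type*} [MeasurableSpace α] {μ : Measure α}
    {e : α → ℂ} {f : α → ℝ} (he : AEStronglyMeasurable e μ) (he1 : ∀ x, ‖e x‖ = 1)
    (hf : Integrable f μ) : Integrable (fun x => e x * (f x : ℂ)) μ :=
  hf.ofReal.bdd_mul he (c := 1) (.of_forall fun x => (he1 x).le)

lemma integrable_exp_mul {f : ℝ → ℝ} (hf : Integrable f) (z : ℝ) :
    Integrable fun x : ℝ => Complex.exp (-(Complex.I * z * x)) * (f x : ℂ) :=
  integrable_mul_ofReal_of_norm_eq_one (continuous_exp_neg_I_mul z).aestronglyMeasurable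
    (norm_exp_neg_I_mul z) hf

lemma fourierIntegralReal_add {f g : ℝ → ℝ} (hf : Integrable f) (hg : Integrable g) (z : ℝ) :
    fourierIntegralReal (fun x => f x + g x) z
      = fourierIntegralReal f z + fourierIntegralReal g z := by
  rw [fourierIntegralReal, fourierIntegralReal, fourierIntegralReal,
    ← integral_add (integrable_exp_mul hf z) (integrable_exp_mul hg z)]
  congr 1 with x
  push_cast
  ring

lemma fourierIntegralReal_const_mul (c : ℝ) (f : ℝ → ℝ) (z : ℝ) :
    fourierIntegralReal (fun x => c * f x) z = c * fourierIntegralReal f z := by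
  rw [fourierIntegralReal, fourierIntegralReal, ← integral_const_mul]
  congr 1 with x
  push_cast
  ring

lemma fourierIntegralReal_sub {f g : ℝ → ℝ} (hf : Integrable f) (hg : Integrable g) (z : ℝ) :
    fourierIntegralReal (fun x => f x - g x) z
      = fourierIntegralReal f z - fourierIntegralReal g z := by
  rw [fourierIntegralReal, fourierIntegralReal, fourierIntegralReal,
    ← integral_sub (integrable_exp_mul hf z) (integrable_exp_mul hg z)]
  congr 1 with x
  push_cast
  ring

lemma fourierIntegralReal_comp_add_right (f : ℝ → ℝ) (y z : ℝ) :
    fourierIntegralReal (fun x => f (x + y)) z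
      = Complex.exp (Complex.I * z * y) * fourierIntegralReal f z := by
  rw [fourierIntegralReal, fourierIntegralReal, ← integral_const_mul,
    ← integral_add_right_eq_self (fun x : ℝ => Complex.exp (Complex.I * z * y) *
      (Complex.exp (-(Complex.I * z * x)) * (f x : ℂ))) y]
  congr 1 with x
  rw [← mul_assoc, ← Complex.exp_add]
  congr 2
  push_cast
  ring

lemma fourierIntegralReal_deriv {f : ℝ → ℝ} (hf : ContDiff ℝ 1 f) (hc : HasCompactSupport f)
    (z : ℝ) : fourierIntegralReal (deriv f) z = Complex.I * z * fourierIntegralReal f z := by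
  have hfi := hf.continuous.integrable_of_hasCompactSupport (μ := volume) hc
  have hdi := (hf.continuous_deriv le_rfl).integrable_of_hasCompactSupport (μ := volume) hc.deriv
  have hu : ∀ x : ℝ, HasDerivAt (fun x : ℝ => Complex.exp (-(Complex.I * z * x)))
      (-(Complex.I * z) * Complex.exp (-(Complex.I * z * x))) x := by
    intro x
    have h := ((hasDerivAt_id x).ofReal_comp.const_mul (Complex.I * z)).fun_neg.cexp
    rw [Complex.ofReal_one, mul_one] at h
    exact h.congr_deriv (mul_comm _ _)
  have hv : ∀ x : ℝ, HasDerivAt (fun x : ℝ => (f x : ℂ)) ((deriv f x : ℝ) : ℂ) x := fun x =>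
    (hf.differentiable one_ne_zero x).hasDerivAt.ofReal_comp
  have hi : ∀ x : ℝ, -(Complex.I * z) * Complex.exp (-(Complex.I * z * x)) * (f x : ℂ)
      = -(Complex.I * z) * (Complex.exp (-(Complex.I * z * x)) * (f x : ℂ)) := fun x => by ring
  have h := integral_mul_deriv_eq_deriv_mul_of_integrable (fun x _ => hu x) (fun x _ => hv x)
    (integrable_exp_mul hdi z) (by
      refine ((integrable_exp_mul hfi z).const_mul (-(Complex.I * z))).congr (.of_forall fun x => ?_)
      exact (hi x).symm) (integrable_exp_mul hfi z)
  rw [fourierIntegralReal, h, fourierIntegralReal]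
  simp_rw [hi]
  rw [integral_const_mul]
  ring

/-- A continuous integrable function whose Fourier transform vanishes is zero, by Fourier
inversion. -/
lemma eq_zero_of_fourierIntegralReal_eq_zero {h : ℝ → ℝ} (hcont : Continuous h)
    (hi : Integrable h) (hz : ∀ z, fourierIntegralReal h z = 0) (x : ℝ) : h x = 0 := by
  have h0 : FourierTransform.fourier (fun x => (h x : ℂ)) = 0 := by
    funext w
    rw [Real.fourier_eq', Pi.zero_apply, ← hz (2 * Real.pi * w), fourierIntegralReal]
    congr 1 with v
    rw [smul_eq_mul]
    congr 2
    simp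
    ring
  have hinv := Continuous.fourierInv_fourier_eq (Complex.continuous_ofReal.comp hcont) hi.ofReal
    (by
      change Integrable (FourierTransform.fourier fun x => (h x : ℂ))
      rw [h0]
      exact integrable_zero _ _ _)
  have hx := congrFun hinv x
  change FourierTransformInv.fourierInv (FourierTransform.fourier fun x => (h x : ℂ)) x
    = (h x : ℂ) at hx
  rw [h0, Real.fourierInv_eq'] at hx
  simpa using hx.symm

variable {f : ℝ → ℝ} {ν : Measure ℝ}

lemma integrable_levyOperator [SFinite ν] (γ : ℝ) (hf : ContDiff ℝ 2 f)
    (hc : HasCompactSupport f) (hν : Integrable (fun y => min 1 (y ^ 2)) ν) :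
    Integrable (levyOperator γ ν f) :=
  (((hf.continuous_deriv (by norm_num)).integrable_of_hasCompactSupport hc.deriv).const_mul γ).add
    (integrable_compensatedIncrement_prod hf hc hν).integral_prod_left

lemma fourierIntegralReal_compensatedIncrement (hf : ContDiff ℝ 2 f) (hc : HasCompactSupport f)
    (y z : ℝ) : fourierIntegralReal (fun x => compensatedIncrement f x y) z
      = (Complex.exp (Complex.I * y * z) - 1
        - (Set.Icc (-1 : ℝ) 1).indicator (fun x : ℝ => Complex.I * x * z) y)
          * fourierIntegralReal f z := by
  have hfi := hf.continuous.integrable_of_hasCompactSupport (μ := volume) hc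
  have hdi := (hf.continuous_deriv (by norm_num)).integrable_of_hasCompactSupport
    (μ := volume) hc.deriv
  unfold compensatedIncrement
  rw [fourierIntegralReal_sub (f := fun x => f (x + y) - f x) ((hfi.comp_add_right y).sub hfi)
      (hdi.const_mul _),
    fourierIntegralReal_sub (hfi.comp_add_right y) hfi, fourierIntegralReal_comp_add_right,
    fourierIntegralReal_const_mul, fourierIntegralReal_deriv (hf.of_le (by norm_num)) hc]
  by_cases hy : y ∈ Set.Icc (-1 : ℝ) 1
  · rw [Set.indicator_of_mem hy, Set.indicator_of_mem hy, mul_right_comm Complex.I]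
    ring
  · rw [Set.indicator_of_notMem hy, Set.indicator_of_notMem hy, mul_right_comm Complex.I]
    push_cast
    ring

/-- On the Fourier side `levyOperator` is multiplication by `-λ`. -/
lemma fourierIntegralReal_levyOperator [SFinite ν] (γ : ℝ) (hf : ContDiff ℝ 2 f)
    (hc : HasCompactSupport f) (hν : Integrable (fun y => min 1 (y ^ 2)) ν) (z : ℝ) :
    fourierIntegralReal (levyOperator γ ν f) z
      = -levyExponent 0 γ ν z * fourierIntegralReal f z := by
  have hdi := (hf.continuous_deriv (by norm_num)).integrable_of_hasCompactSupport
    (μ := volume) hc.deriv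
  have hK := integrable_compensatedIncrement_prod hf hc hν
  have hint : fourierIntegralReal (fun x => ∫ y, compensatedIncrement f x y ∂ν) z
      = ∫ y, fourierIntegralReal (fun x => compensatedIncrement f x y) z ∂ν := by
    unfold fourierIntegralReal
    rw [← integral_integral_swap]
    · congr 1 with x
      rw [integral_const_mul, integral_complex_ofReal]
    · exact integrable_mul_ofReal_of_norm_eq_one
        (e := fun p : ℝ × ℝ => Complex.exp (-(Complex.I * z * p.1)))
        ((continuous_exp_neg_I_mul z).comp continuous_fst).aestronglyMeasurable
        (fun p => norm_exp_neg_I_mul z p.1) hK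
  unfold levyOperator
  rw [fourierIntegralReal_add (hdi.const_mul γ) hK.integral_prod_left,
    fourierIntegralReal_const_mul, fourierIntegralReal_deriv (hf.of_le (by norm_num)) hc, hint]
  simp_rw [fourierIntegralReal_compensatedIncrement hf hc]
  rw [integral_mul_const, levyExponent]
  push_cast
  ring

end Fourier

/-! ### The generator of a Lévy process -/

section Generator

variable {Ω : Type*} [MeasurableSpace Ω] {P : Measure Ω} [IsProbabilityMeasure P]
  {X : ℝ≥0 → Ω → ℝ}

lemma integrable_add_prod_map (hX : ∀ t, AEMeasurable (X t) P) {g : ℝ → ℝ} (hg : Integrable g)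
    (t : ℝ≥0) : Integrable (fun p : ℝ × ℝ => g (p.1 + p.2)) (volume.prod (P.map (X t))) := by
  have : IsProbabilityMeasure (P.map (X t)) := Measure.isProbabilityMeasure_map (hX t)
  exact (measurePreserving_add_prod (volume : Measure ℝ) (P.map (X t))).integrable_comp_of_integrable
    (hg.comp_fst (P.map (X t)))

lemma integrable_transitionOp (hX : ∀ t, AEMeasurable (X t) P) {g : ℝ → ℝ} (hg : Continuous g)
    (hgi : Integrable g) (t : ℝ≥0) : Integrable (transitionOp P X t g) := by
  have : IsProbabilityMeasure (P.map (X t)) := Measure.isProbabilityMeasure_map (hX t)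
  rw [funext (transitionOp_eq_integral_map hX hg t)]
  exact (integrable_add_prod_map hX hgi t).integral_prod_left

lemma integral_norm_transitionOp_le (hX : ∀ t, AEMeasurable (X t) P) {g : ℝ → ℝ}
    (hg : Continuous g) (hgi : Integrable g) (t : ℝ≥0) :
    ∫ x, ‖transitionOp P X t g x‖ ≤ ∫ x, ‖g x‖ := by
  have : IsProbabilityMeasure (P.map (X t)) := Measure.isProbabilityMeasure_map (hX t)
  have hI := (integrable_add_prod_map hX hgi t).norm
  calc ∫ x, ‖transitionOp P X t g x‖
      ≤ ∫ x, ∫ y, ‖g (x + y)‖ ∂(P.map (X t)) := by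
        refine integral_mono (integrable_transitionOp hX hg hgi t).norm hI.integral_prod_left
          fun x => ?_
        change ‖transitionOp P X t g x‖ ≤ _
        rw [transitionOp_eq_integral_map hX hg]
        exact norm_integral_le_integral_norm _
    _ = ∫ y, (∫ x, ‖g (x + y)‖) ∂(P.map (X t)) :=
        integral_integral_swap (f := fun x y => ‖g (x + y)‖) hI
    _ = ∫ x, ‖g x‖ := by
        simp_rw [integral_add_right_eq_self fun x => ‖g x‖]
        simp

variable {γ : ℝ} {ν : Measure ℝ}

/-- On the Fourier side `P_t` is multiplication by `exp (-t λ)`. -/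
lemma fourierIntegralReal_transitionOp (hX : ∀ t, AEMeasurable (X t) P)
    (hL : HasLevyTriplet P X 0 γ ν) {g : ℝ → ℝ} (hg : Continuous g) (hgi : Integrable g)
    (t : ℝ≥0) (z : ℝ) : fourierIntegralReal (transitionOp P X t g) z
      = Complex.exp (-(t : ℂ) * levyExponent 0 γ ν z) * fourierIntegralReal g z := by
  have : IsProbabilityMeasure (P.map (X t)) := Measure.isProbabilityMeasure_map (hX t)
  have hswap : fourierIntegralReal (transitionOp P X t g) z
      = ∫ y, fourierIntegralReal (fun x => g (x + y)) z ∂(P.map (X t)) := by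
    unfold fourierIntegralReal
    rw [← integral_integral_swap]
    · congr 1 with x
      rw [transitionOp_eq_integral_map hX hg, integral_const_mul, integral_complex_ofReal]
    · exact integrable_mul_ofReal_of_norm_eq_one
        (e := fun p : ℝ × ℝ => Complex.exp (-(Complex.I * z * p.1)))
        ((continuous_exp_neg_I_mul z).comp continuous_fst).aestronglyMeasurable
        (fun p => norm_exp_neg_I_mul z p.1) (integrable_add_prod_map hX hgi t)
  have hm : Continuous fun y : ℝ => Complex.exp (Complex.I * z * y) := by fun_prop
  simp_rw [hswap, fourierIntegralReal_comp_add_right]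
  rw [integral_mul_const, integral_map (hX t) hm.aestronglyMeasurable, hL]

/-- For `g = levyOperator γ ν f` the Fourier transforms of both sides agree, because the first is
`(exp (-t λ) - 1) f̂` and `exp (-s λ) (-λ f̂)` is the derivative of `exp (-s λ) f̂` in `s`. -/
lemma transitionOp_sub_eq_integral (hX : IsLevyProcess P X) [SFinite ν]
    (hL : HasLevyTriplet P X 0 γ ν) (hν : Integrable (fun y => min 1 (y ^ 2)) ν) (f : C₀(ℝ, ℝ))
    (hf : ContDiff ℝ 2 f) (hc : HasCompactSupport f) (t : ℝ≥0) (x : ℝ) :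
    transitionOp P X t f x - f x
      = ∫ s in (0 : ℝ)..t, transitionOp P X s.toNNReal (levyOperatorC0 γ hf hc hν) x := by
  set g : C₀(ℝ, ℝ) := levyOperatorC0 γ hf hc hν with hg
  have hm := hX.aemeasurable
  have hcp := hX.continuous_in_probability
  have hfi : Integrable f := hf.continuous.integrable_of_hasCompactSupport hc
  have hgi : Integrable g := integrable_levyOperator γ hf hc hν
  have hgc : Continuous g := map_continuous g
  have hfc : Continuous f := map_continuous f
  have hcont : Continuous fun p : ℝ × ℝ => transitionOp P X p.1.toNNReal g p.2 :=
    (continuous_transitionOp_uncurry hm hcp g).comp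
      ((continuous_real_toNNReal.comp continuous_fst).prodMk continuous_snd)
  have hprod : Integrable (fun p : ℝ × ℝ => transitionOp P X p.1.toNNReal g p.2)
      ((volume.restrict (Set.Ioc (0 : ℝ) t)).prod volume) := by
    rw [integrable_prod_iff hcont.aestronglyMeasurable]
    refine ⟨.of_forall fun s => integrable_transitionOp hm hgc hgi s.toNNReal, ?_⟩
    refine Integrable.of_bound hcont.norm.aestronglyMeasurable.integral_prod_right'
      (∫ x, ‖g x‖) (.of_forall fun s => ?_)
    rw [Real.norm_of_nonneg (integral_nonneg fun _ => norm_nonneg _)]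
    exact integral_norm_transitionOp_le hm hgc hgi s.toNNReal
  have ht : (0 : ℝ) ≤ t := t.2
  have hTi : Integrable fun x => ∫ s in (0 : ℝ)..t, transitionOp P X s.toNNReal g x := by
    simp_rw [intervalIntegral.integral_of_le ht]
    exact hprod.integral_prod_right
  have hTf : Integrable fun x => transitionOp P X t f x - f x :=
    (integrable_transitionOp hm hfc hfi t).sub hfi
  refine sub_eq_zero.1 (eq_zero_of_fourierIntegralReal_eq_zero
    (h := fun x => transitionOp P X t f x - f x - ∫ s in (0 : ℝ)..t, transitionOp P X s.toNNReal g x)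
    (Continuous.sub (Continuous.sub ?_ hfc) ?_) (hTf.sub hTi) (fun z => ?_) x)
  · exact (continuous_transitionOp_uncurry hm hcp f).comp (continuous_const.prodMk continuous_id)
  · exact intervalIntegral.continuous_parametric_intervalIntegral_of_continuous'
      (f := fun x s => transitionOp P X s.toNNReal g x) (hcont.comp continuous_swap) _ _
  · rw [fourierIntegralReal_sub hTf hTi,
      fourierIntegralReal_sub (integrable_transitionOp hm hfc hfi t) hfi,
      fourierIntegralReal_transitionOp hm hL hfc hfi]
    have hswap : fourierIntegralReal
          (fun x => ∫ s in (0 : ℝ)..t, transitionOp P X s.toNNReal g x) z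
        = ∫ s in (0 : ℝ)..t, fourierIntegralReal (transitionOp P X s.toNNReal g) z := by
      unfold fourierIntegralReal
      simp_rw [intervalIntegral.integral_of_le ht]
      rw [integral_integral_swap]
      · congr 1 with x
        rw [integral_const_mul, integral_complex_ofReal]
      · exact integrable_mul_ofReal_of_norm_eq_one
          (e := fun p : ℝ × ℝ => Complex.exp (-(Complex.I * z * p.2)))
          ((continuous_exp_neg_I_mul z).comp continuous_snd).aestronglyMeasurable
          (fun p => norm_exp_neg_I_mul z p.2) hprod
    have hderiv : ∀ s : ℝ, HasDerivAt
        (fun s : ℝ => Complex.exp (-(s : ℂ) * levyExponent 0 γ ν z) * fourierIntegralReal f z)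
        (Complex.exp (-(s : ℂ) * levyExponent 0 γ ν z) *
          (-levyExponent 0 γ ν z * fourierIntegralReal f z)) s := by
      intro s
      have h := (((hasDerivAt_id s).ofReal_comp.fun_neg.mul_const
        (levyExponent 0 γ ν z)).cexp).mul_const (fourierIntegralReal f z)
      refine h.congr_deriv ?_
      simp only [id, Complex.ofReal_one]
      ring
    have hint : ∫ s in (0 : ℝ)..t, fourierIntegralReal (transitionOp P X s.toNNReal g) z
        = Complex.exp (-(t : ℂ) * levyExponent 0 γ ν z) * fourierIntegralReal f z
          - fourierIntegralReal f z := by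
      have h := intervalIntegral.integral_eq_sub_of_hasDerivAt (a := 0) (b := t)
        (fun s _ => hderiv s) (Continuous.intervalIntegrable (by fun_prop) _ _)
      rw [Complex.ofReal_zero, neg_zero, zero_mul, Complex.exp_zero, one_mul] at h
      rw [← show ((t : ℝ) : ℂ) = (t : ℂ) from rfl, ← h]
      refine intervalIntegral.integral_congr fun s hs => ?_
      rw [Set.uIcc_of_le ht] at hs
      rw [fourierIntegralReal_transitionOp hm hL hgc hgi,
        show fourierIntegralReal g z = _ from fourierIntegralReal_levyOperator γ hf hc hν z,
        show ((s.toNNReal : ℝ≥0) : ℂ) = (s : ℂ) by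
          rw [← Real.coe_toNNReal s hs.1]; simp]
    rw [hswap, hint, sub_self]

/-- Compactly supported `C²` functions lie in the domain of the generator, which acts on them as
`levyOperator`. -/
theorem isGeneratorValue_levyOperatorC0 (hX : IsLevyProcess P X) [SFinite ν]
    (hL : HasLevyTriplet P X 0 γ ν) (hν : Integrable (fun y => min 1 (y ^ 2)) ν) (f : C₀(ℝ, ℝ))
    (hf : ContDiff ℝ 2 f) (hc : HasCompactSupport f) :
    IsGeneratorValue P X f (levyOperatorC0 γ hf hc hν) := by
  set g : C₀(ℝ, ℝ) := levyOperatorC0 γ hf hc hν with hg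
  have hm := hX.aemeasurable
  have hcp := hX.continuous_in_probability
  have hzero : ∀ x, transitionOp P X 0 g x = g x := by
    intro x
    rw [transitionOp_eq_integral hm (map_continuous g), integral_congr_ae (g := fun _ => g x)]
    · simp
    · filter_upwards [hX.start_zero] with ω hω
      rw [hω, add_zero]
  rw [IsGeneratorValue, Metric.tendstoUniformly_iff]
  intro ε hε
  have h0 := Metric.tendstoUniformly_iff.1 (tendstoUniformly_transitionOp hm (hcp 0) g) (ε / 2)
    (half_pos hε)
  obtain ⟨δ, hδ, hball⟩ := Metric.eventually_nhds_iff.1 h0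
  have hlt : ∀ᶠ t : ℝ≥0 in 𝓝[>] 0, dist t 0 < δ :=
    mem_nhdsWithin_of_mem_nhds (Metric.ball_mem_nhds 0 hδ)
  filter_upwards [hlt, self_mem_nhdsWithin] with t ht htpos x
  have ht0 : (0 : ℝ) < t := htpos
  have hcs : Continuous fun s : ℝ => transitionOp P X s.toNNReal g x :=
    (continuous_transitionOp_uncurry hm hcp g).comp
      (continuous_real_toNNReal.prodMk continuous_const)
  rw [transitionOp_sub_eq_integral hX hL hν f hf hc, ← hg, dist_comm, dist_eq_norm]
  have e : (∫ s in (0 : ℝ)..t, transitionOp P X s.toNNReal g x) / t - g x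
      = (∫ s in (0 : ℝ)..t, (transitionOp P X s.toNNReal g x - g x)) / t := by
    rw [intervalIntegral.integral_sub (hcs.intervalIntegrable _ _)
      intervalIntegrable_const, intervalIntegral.integral_const]
    simp only [sub_zero, smul_eq_mul]
    field_simp
  have hb : ‖∫ s in (0 : ℝ)..t, (transitionOp P X s.toNNReal g x - g x)‖
      ≤ ε / 2 * |(t : ℝ) - 0| := by
    refine intervalIntegral.norm_integral_le_of_norm_le_const fun s hs => ?_
    rw [Set.uIoc_of_le ht0.le] at hs
    have hs' : dist s.toNNReal 0 < δ := by
      refine lt_of_le_of_lt ?_ ht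
      rw [NNReal.dist_eq, NNReal.dist_eq, Real.coe_toNNReal s hs.1.le]
      simpa [abs_of_pos hs.1] using hs.2
    have := hball hs' x
    rw [hzero, dist_comm, dist_eq_norm] at this
    exact this.le
  rw [sub_zero, abs_of_pos ht0] at hb
  rw [e, norm_div, Real.norm_of_nonneg ht0.le, div_lt_iff₀ ht0]
  nlinarith

end Generator

/-! ### The one-sided kernel and integration by parts -/

section StableProfile

open Set

/-- The function on `(0, ∞)` from which both halves of `stableK0` are built: `-log u` for `α = 1`
and `u ^ (1 - α) / (α (α - 1))` otherwise. Its second derivative is `u ^ (-α - 1)`. -/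
noncomputable def stableProfile (α u : ℝ) : ℝ :=
  if α = 1 then -Real.log u else 1 / (α * (α - 1)) * u ^ (1 - α)

variable {α : ℝ}

lemma hasDerivAt_stableProfile (hα : 0 < α) {u : ℝ} (hu : 0 < u) :
    HasDerivAt (stableProfile α) (-u ^ (-α) / α) u := by
  by_cases h1 : α = 1
  · have e : stableProfile α = fun u => -Real.log u := by
      funext v
      simp [stableProfile, h1]
    rw [e, h1, Real.rpow_neg_one, div_one]
    exact (Real.hasDerivAt_log hu.ne').neg
  · have e : stableProfile α = fun u => 1 / (α * (α - 1)) * u ^ (1 - α) := by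
      funext v
      simp [stableProfile, h1]
    rw [e]
    refine ((Real.hasDerivAt_rpow_const (.inl hu.ne')).const_mul _).congr_deriv ?_
    rw [show 1 - α - 1 = -α by ring]
    have : α - 1 ≠ 0 := sub_ne_zero.2 h1
    field_simp
    ring

lemma hasDerivAt_deriv_stableProfile (hα : 0 < α) {u : ℝ} (hu : 0 < u) :
    HasDerivAt (fun u : ℝ => -u ^ (-α) / α) (u ^ (-α - 1)) u := by
  refine ((Real.hasDerivAt_rpow_const (p := -α) (.inl hu.ne')).fun_neg.div_const α).congr_deriv ?_
  field_simp

lemma intervalIntegrable_stableProfile (hα : α < 2) (a b : ℝ) :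
    IntervalIntegrable (stableProfile α) volume a b := by
  by_cases h1 : α = 1
  · have e : stableProfile α = fun u => -Real.log u := by
      funext v
      simp [stableProfile, h1]
    rw [e]
    exact intervalIntegral.intervalIntegrable_log'.neg
  · have e : stableProfile α = fun u => 1 / (α * (α - 1)) * u ^ (1 - α) := by
      funext v
      simp [stableProfile, h1]
    rw [e]
    exact (intervalIntegral.intervalIntegrable_rpow' (by linarith)).const_mul _

lemma locallyIntegrable_indicator_stableProfile (hα : α < 2) :
    LocallyIntegrable ((Ioi (0 : ℝ)).indicator (stableProfile α)) := by
  rw [locallyIntegrable_iff]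
  intro k hk
  obtain ⟨R, hR⟩ := hk.isBounded.subset_closedBall 0
  rw [Real.closedBall_eq_Icc, zero_sub, zero_add] at hR
  have h := (intervalIntegrable_iff.1 (intervalIntegrable_stableProfile hα 0 |R|))
  rw [uIoc_of_le (abs_nonneg R)] at h
  rw [IntegrableOn, integrable_indicator_iff measurableSet_Ioi, IntegrableOn,
    Measure.restrict_restrict measurableSet_Ioi]
  exact h.mono_set fun x hx => ⟨hx.1, (hR hx.2).2.trans (le_abs_self R)⟩

lemma tendsto_stableProfile_mul_self (hα : α < 2) :
    Tendsto (fun u => stableProfile α u * u) (𝓝[>] 0) (𝓝 0) := by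
  by_cases h1 : α = 1
  · have h := (tendsto_log_mul_rpow_nhdsGT_zero one_pos).neg
    simpa [stableProfile, h1] using h
  · have h : Tendsto (fun u : ℝ => 1 / (α * (α - 1)) * u ^ (2 - α)) (𝓝[>] 0) (𝓝 0) := by
      have := ((Real.continuousAt_rpow_const 0 (2 - α) (.inr (by linarith))).tendsto.mono_left
        (nhdsWithin_le_nhds (s := Ioi 0))).const_mul (1 / (α * (α - 1)))
      rwa [Real.zero_rpow (by linarith), mul_zero] at this
    refine h.congr' ?_
    filter_upwards [self_mem_nhdsWithin] with u hu
    rw [stableProfile, if_neg h1, mul_assoc, ← Real.rpow_add_one (ne_of_gt hu)]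
    ring_nf

lemma tendsto_deriv_stableProfile_mul_sq (hα : α < 2) :
    Tendsto (fun u : ℝ => u ^ (-α) / α * u ^ 2) (𝓝[>] 0) (𝓝 0) := by
  have h : Tendsto (fun u : ℝ => u ^ (2 - α) / α) (𝓝[>] 0) (𝓝 0) := by
    have := ((Real.continuousAt_rpow_const 0 (2 - α) (.inr (by linarith))).tendsto.mono_left
      (nhdsWithin_le_nhds (s := Ioi 0))).div_const α
    rwa [Real.zero_rpow (by linarith), zero_div] at this
  refine h.congr' ?_
  filter_upwards [self_mem_nhdsWithin] with u hu
  rw [div_mul_eq_mul_div, ← Real.rpow_natCast, ← Real.rpow_add hu]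
  congr 2
  push_cast
  ring

lemma integrableOn_rpow_mul_min (hα₀ : 0 < α) (hα : α < 2) :
    IntegrableOn (fun u : ℝ => u ^ (-α - 1) * min 1 (u ^ 2)) (Ioi 0) := by
  rw [← Ioc_union_Ioi_eq_Ioi zero_le_one]
  refine IntegrableOn.union ?_ ?_
  · have h := intervalIntegrable_iff.1
      (intervalIntegral.intervalIntegrable_rpow' (a := 0) (b := 1) (r := 1 - α) (by linarith))
    rw [uIoc_of_le zero_le_one] at h
    refine h.congr_fun (fun u hu => ?_) measurableSet_Ioc
    change u ^ (1 - α) = u ^ (-α - 1) * min 1 (u ^ 2)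
    rw [min_eq_right (by nlinarith [hu.1, hu.2]), ← Real.rpow_natCast, ← Real.rpow_add hu.1]
    congr 1
    push_cast
    ring
  · refine (integrableOn_Ioi_rpow_of_lt (a := -α - 1) (by linarith) one_pos).congr_fun
      (fun u hu => ?_) measurableSet_Ioi
    have : (1 : ℝ) < u := hu
    rw [min_eq_left (by nlinarith), mul_one]

lemma integrableOn_rpow_mul_compensatedIncrement (hα₀ : 0 < α) (hα : α < 2) {F : ℝ → ℝ}
    (hF : ContDiff ℝ 2 F) (hc : HasCompactSupport F) :
    IntegrableOn (fun u => u ^ (-α - 1) * compensatedIncrement F 0 u) (Ioi 0) := by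
  obtain ⟨C, -, hC⟩ := exists_compensatedIncrement_bound hF hc
  refine ((integrableOn_rpow_mul_min hα₀ hα).const_mul C).mono' ?_ ?_
  · exact ((measurable_id.pow_const _).mul ((measurable_compensatedIncrement hF).comp
      measurable_prodMk_left)).aestronglyMeasurable
  · refine (ae_restrict_iff' measurableSet_Ioi).2 (.of_forall fun u hu => ?_)
    have hp : 0 ≤ u ^ (-α - 1) := Real.rpow_nonneg (le_of_lt hu) _
    rw [norm_mul, Real.norm_of_nonneg hp]
    nlinarith [mul_le_mul_of_nonneg_left (hC 0 u) hp]

/-- Integrating by parts twice on `(0, 1]` and on `(1, ∞)` moves both derivatives from `F` to the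
profile. The boundary terms at `0` vanish since `F'(u) - F'(0) = O(u)` and
`F(u) - F(0) - u F'(0) = O(u²)`; those at `1` combine to a multiple of `F'(0)`. -/
lemma setIntegral_stableProfile_mul_deriv_deriv (hα₀ : 0 < α) (hα : α < 2) {F : ℝ → ℝ}
    (hF : ContDiff ℝ 2 F) (hc : HasCompactSupport F) :
    ∫ u in Ioi (0 : ℝ), stableProfile α u * deriv (deriv F) u
      = (∫ u in Ioi (0 : ℝ), u ^ (-α - 1) * compensatedIncrement F 0 u)
        - (stableProfile α 1 + 1 / α) * deriv F 0 := by
  obtain ⟨M, hM⟩ := hc.deriv.deriv.exists_bound_of_continuous hF.continuous_deriv_deriv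
  have hi1 : IntegrableOn (fun u => stableProfile α u * deriv (deriv F) u) (Ioi 0) := by
    have h := (locallyIntegrable_indicator_stableProfile
      hα).integrable_smul_right_of_hasCompactSupport hF.continuous_deriv_deriv hc.deriv.deriv
    rw [← integrable_indicator_iff measurableSet_Ioi]
    refine h.congr (.of_forall fun u => ?_)
    by_cases hu : u ∈ Ioi (0 : ℝ) <;> simp [hu]
  have hi2 := integrableOn_rpow_mul_compensatedIncrement hα₀ hα hF hc
  suffices h : ∫ u in Ioi (0 : ℝ), (stableProfile α u * deriv (deriv F) u
      - u ^ (-α - 1) * compensatedIncrement F 0 u)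
      = -((stableProfile α 1 + 1 / α) * deriv F 0) by
    rw [integral_sub hi1 hi2] at h
    linarith
  have hi : IntegrableOn (fun u => stableProfile α u * deriv (deriv F) u
      - u ^ (-α - 1) * compensatedIncrement F 0 u) (Ioi 0) := hi1.sub hi2
  rw [← intervalIntegral.integral_interval_add_Ioi hi
    (hi.mono_set (Ioi_subset_Ioi zero_le_one))]
  have hk := fun {u : ℝ} (hu : 0 < u) => hasDerivAt_stableProfile hα₀ hu
  have hk' := fun {u : ℝ} (hu : 0 < u) => hasDerivAt_deriv_stableProfile hα₀ hu
  -- An antiderivative on `(0, 1]`; it tends to `0` at `0`.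
  have hd1 : ∀ u : ℝ, 0 < u → HasDerivAt (fun u => stableProfile α u * (deriv F u - deriv F 0)
      - -u ^ (-α) / α * (F u - F 0 - u * deriv F 0))
      (stableProfile α u * deriv (deriv F) u - u ^ (-α - 1) * (F u - F 0 - u * deriv F 0)) u := by
    intro u hu
    have h := ((hk hu).fun_mul ((hF.hasDerivAt_deriv u).sub_const (deriv F 0))).fun_sub
      ((hk' hu).fun_mul (((hF.hasDerivAt_self u).sub_const (F 0)).fun_sub
        ((hasDerivAt_id u).mul_const (deriv F 0))))
    refine h.congr_deriv ?_
    simp only [id]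
    ring
  have hlim : Tendsto (fun u => stableProfile α u * (deriv F u - deriv F 0)
      - -u ^ (-α) / α * (F u - F 0 - u * deriv F 0)) (𝓝[>] 0) (𝓝 0) := by
    have hM0 : 0 ≤ M := (norm_nonneg _).trans (hM 0)
    have hb := ((tendsto_stableProfile_mul_self hα).abs.const_mul M).add
      ((tendsto_deriv_stableProfile_mul_sq hα).const_mul M)
    rw [abs_zero, mul_zero, add_zero] at hb
    refine squeeze_zero_norm' ?_ hb
    filter_upwards [self_mem_nhdsWithin] with u hu
    have hu0 : 0 < u := hu
    have h1 : ‖deriv F u - deriv F 0‖ ≤ M * u := by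
      have := Convex.norm_image_sub_le_of_norm_deriv_le (f := deriv F) (x := 0) (y := u)
        (fun v _ => (hF.hasDerivAt_deriv v).differentiableAt) (fun v _ => hM v) convex_univ
        (mem_univ _) (mem_univ _)
      rwa [sub_zero, Real.norm_of_nonneg hu0.le] at this
    have h2 := abs_sub_sub_mul_deriv_le hF hM 0 u
    rw [zero_add] at h2
    have hp : 0 ≤ u ^ (-α) / α := by positivity
    refine (norm_sub_le _ _).trans (add_le_add ?_ ?_)
    · rw [norm_mul, abs_mul, abs_of_pos hu0, Real.norm_eq_abs (stableProfile α u)]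
      nlinarith [mul_le_mul_of_nonneg_left h1 (abs_nonneg (stableProfile α u))]
    · rw [norm_mul, neg_div, norm_neg, Real.norm_of_nonneg hp]
      nlinarith [mul_le_mul_of_nonneg_left h2 hp]
  have hI1 : ∫ u in (0 : ℝ)..1, (stableProfile α u * deriv (deriv F) u
      - u ^ (-α - 1) * compensatedIncrement F 0 u)
      = stableProfile α 1 * (deriv F 1 - deriv F 0) + 1 / α * (F 1 - F 0 - deriv F 0) := by
    rw [intervalIntegral.integral_eq_sub_of_hasDerivAt_of_tendsto zero_lt_one (fun u hu => ?_)
      ((intervalIntegrable_iff_integrableOn_Ioc_of_le zero_le_one).2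
        (hi.mono_set Ioc_subset_Ioi_self)) hlim
      ((hd1 1 one_pos).continuousAt.tendsto.mono_left nhdsWithin_le_nhds)]
    · rw [Real.one_rpow]
      ring
    · rw [compensatedIncrement, indicator_of_mem (show u ∈ Icc (-1 : ℝ) 1 from ⟨by linarith [hu.1], hu.2.le⟩), zero_add]
      exact hd1 u hu.1
  -- An antiderivative on `(1, ∞)`; it tends to `0` at infinity.
  have hd2 : ∀ u : ℝ, 0 < u → HasDerivAt (fun u => stableProfile α u * deriv F u
      - -u ^ (-α) / α * (F u - F 0))
      (stableProfile α u * deriv (deriv F) u - u ^ (-α - 1) * (F u - F 0)) u := by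
    intro u hu
    refine (((hk hu).fun_mul (hF.hasDerivAt_deriv u)).fun_sub
      ((hk' hu).fun_mul ((hF.hasDerivAt_self u).sub_const (F 0)))).congr_deriv ?_
    ring
  have hlim2 : Tendsto (fun u => stableProfile α u * deriv F u
      - -u ^ (-α) / α * (F u - F 0)) atTop (𝓝 0) := by
    have h0 := ((tendsto_rpow_neg_atTop hα₀).div_const α).mul_const (-F 0)
    rw [zero_div, zero_mul] at h0
    have hz : ∀ᶠ u in atTop, F u = 0 ∧ deriv F u = 0 := by
      have h := (hasCompactSupport_iff_eventuallyEq.1 hc).and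
        (hasCompactSupport_iff_eventuallyEq.1 hc.deriv)
      rw [coclosedCompact_eq_cocompact] at h
      exact atTop_le_cocompact h
    refine h0.congr' ?_
    filter_upwards [hz] with u hu
    rw [hu.1, hu.2]
    ring
  have hI2 : ∫ u in Ioi (1 : ℝ), (stableProfile α u * deriv (deriv F) u
      - u ^ (-α - 1) * compensatedIncrement F 0 u)
      = -(stableProfile α 1 * deriv F 1) - 1 / α * (F 1 - F 0) := by
    have e : EqOn (fun u => stableProfile α u * deriv (deriv F) u
        - u ^ (-α - 1) * compensatedIncrement F 0 u) (fun u => stableProfile α u * deriv (deriv F) u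
        - u ^ (-α - 1) * (F u - F 0)) (Ioi 1) := by
      intro u hu
      have hu' : u ∉ Icc (-1 : ℝ) 1 := fun h => absurd h.2 (not_le.2 hu)
      simp only [compensatedIncrement]
      rw [indicator_of_notMem hu', zero_add, zero_mul, sub_zero]
    rw [setIntegral_congr_fun measurableSet_Ioi e,
      integral_Ioi_of_hasDerivAt_of_tendsto' (fun u hu => hd2 u (one_pos.trans_le hu))
        ((hi.mono_set (Ioi_subset_Ioi zero_le_one)).congr_fun e measurableSet_Ioi) hlim2,
      Real.one_rpow]
    ring
  rw [hI1, hI2]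
  ring

end StableProfile

/-! ### Two-sided kernels -/

section TwoSided

open Set

/-- The function on `ℝ` equal to `C₂ φ(y)` for `y > 0`, to `C₁ φ(-y)` for `y < 0` and to `0`
at `0`. -/
noncomputable def twoSided (φ : ℝ → ℝ) (C₁ C₂ y : ℝ) : ℝ :=
  C₂ * (Ioi (0 : ℝ)).indicator φ y + C₁ * (Ioi (0 : ℝ)).indicator φ (-y)

lemma twoSided_of_pos (φ : ℝ → ℝ) (C₁ C₂ : ℝ) {y : ℝ} (hy : 0 < y) :
    twoSided φ C₁ C₂ y = C₂ * φ y := by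
  have h : -y ∉ Ioi (0 : ℝ) := by simpa using hy.le
  rw [twoSided, indicator_of_mem (show y ∈ Ioi (0 : ℝ) from hy), indicator_of_notMem h, mul_zero,
    add_zero]

lemma twoSided_of_neg (φ : ℝ → ℝ) (C₁ C₂ : ℝ) {y : ℝ} (hy : y < 0) :
    twoSided φ C₁ C₂ y = C₁ * φ (-y) := by
  have h : y ∉ Ioi (0 : ℝ) := by simpa using hy.le
  rw [twoSided, indicator_of_mem (show -y ∈ Ioi (0 : ℝ) from neg_pos.2 hy), indicator_of_notMem h,
    mul_zero, zero_add]

lemma twoSided_zero (φ : ℝ → ℝ) (C₁ C₂ : ℝ) : twoSided φ C₁ C₂ 0 = 0 := by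
  simp [twoSided]

lemma stableK0_eq_twoSided (α C₁ C₂ : ℝ) :
    stableK0 α C₁ C₂ = twoSided (stableProfile α) C₁ C₂ := by
  funext y
  rw [stableK0]
  rcases lt_trichotomy y 0 with hy | rfl | hy
  · rw [twoSided_of_neg _ _ _ hy, if_pos hy, if_neg hy.not_gt, abs_of_neg hy, add_zero, mul_comm,
      stableProfile]
  · simp [twoSided_zero]
  · rw [twoSided_of_pos _ _ _ hy, if_neg hy.not_gt, if_pos hy, abs_of_pos hy, zero_add, mul_comm,
      stableProfile]

lemma stableDensity_eq_twoSided (α C₁ C₂ : ℝ) :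
    stableDensity α C₁ C₂ = twoSided (fun u => u ^ (-α - 1)) C₁ C₂ := by
  funext y
  rw [stableDensity]
  rcases lt_trichotomy y 0 with hy | rfl | hy
  · rw [twoSided_of_neg _ _ _ hy, if_pos hy, if_neg hy.not_gt, abs_of_neg hy, add_zero, mul_comm]
  · simp [twoSided_zero]
  · rw [twoSided_of_pos _ _ _ hy, if_neg hy.not_gt, if_pos hy, abs_of_pos hy, zero_add, mul_comm]

lemma p0_eq_twoSided : p0 = twoSided (fun _ => 1) (1 / 2) (-(1 / 2)) := by
  funext y
  rw [p0]
  rcases lt_trichotomy y 0 with hy | rfl | hy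
  · rw [twoSided_of_neg _ _ _ hy, Real.sign_of_neg hy]
    norm_num
  · simp [twoSided_zero]
  · rw [twoSided_of_pos _ _ _ hy, Real.sign_of_pos hy]

lemma locallyIntegrable_comp_neg {k : ℝ → ℝ} (hk : LocallyIntegrable k) :
    LocallyIntegrable fun t => k (-t) := by
  change LocallyIntegrable (k ∘ Homeomorph.neg ℝ)
  rw [← locallyIntegrable_map_homeomorph]
  change LocallyIntegrable _ (Measure.map Neg.neg volume)
  rwa [Measure.map_neg_eq_self]

lemma locallyIntegrable_twoSided {φ : ℝ → ℝ}
    (hφ : LocallyIntegrable ((Ioi (0 : ℝ)).indicator φ)) (C₁ C₂ : ℝ) :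
    LocallyIntegrable (twoSided φ C₁ C₂) :=
  (hφ.smul C₂).add ((locallyIntegrable_comp_neg hφ).smul C₁)

lemma twoSided_mul (φ G : ℝ → ℝ) (C₁ C₂ y : ℝ) : twoSided φ C₁ C₂ y * G y
    = C₂ * (Ioi (0 : ℝ)).indicator (fun u => φ u * G u) y
      + C₁ * (Ioi (0 : ℝ)).indicator (fun u => φ u * G (-u)) (-y) := by
  rw [twoSided, indicator_mul_left, indicator_mul_left, neg_neg]
  ring

lemma integrable_twoSided_mul {φ G : ℝ → ℝ} (h₂ : IntegrableOn (fun u => φ u * G u) (Ioi 0))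
    (h₁ : IntegrableOn (fun u => φ u * G (-u)) (Ioi 0)) (C₁ C₂ : ℝ) :
    Integrable fun y => twoSided φ C₁ C₂ y * G y := by
  simp_rw [twoSided_mul]
  exact ((h₂.integrable_indicator measurableSet_Ioi).const_mul C₂).add
    ((h₁.integrable_indicator measurableSet_Ioi).comp_neg.const_mul C₁)

lemma integral_twoSided_mul {φ G : ℝ → ℝ} (h₂ : IntegrableOn (fun u => φ u * G u) (Ioi 0))
    (h₁ : IntegrableOn (fun u => φ u * G (-u)) (Ioi 0)) (C₁ C₂ : ℝ) :
    ∫ y, twoSided φ C₁ C₂ y * G y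
      = C₂ * (∫ u in Ioi (0 : ℝ), φ u * G u) + C₁ * ∫ u in Ioi (0 : ℝ), φ u * G (-u) := by
  simp_rw [twoSided_mul]
  rw [integral_add ((h₂.integrable_indicator measurableSet_Ioi).const_mul C₂)
    ((h₁.integrable_indicator measurableSet_Ioi).comp_neg.const_mul C₁), integral_const_mul,
    integral_const_mul, integral_neg_eq_self, integral_indicator measurableSet_Ioi,
    integral_indicator measurableSet_Ioi]

lemma integrableOn_mul_of_hasCompactSupport {φ G : ℝ → ℝ}
    (hφ : LocallyIntegrable ((Ioi (0 : ℝ)).indicator φ)) (hG : Continuous G)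
    (hc : HasCompactSupport G) : IntegrableOn (fun u => φ u * G u) (Ioi 0) := by
  rw [← integrable_indicator_iff measurableSet_Ioi]
  refine (hφ.integrable_smul_right_of_hasCompactSupport hG hc).congr (.of_forall fun u => ?_)
  rw [indicator_mul_left]
  rfl

end TwoSided

/-! ### The stable Lévy measure and its kernel -/

section Stable

open Set

variable {α C₁ C₂ : ℝ}

lemma stableDensity_nonneg (hC₁ : 0 ≤ C₁) (hC₂ : 0 ≤ C₂) (y : ℝ) : 0 ≤ stableDensity α C₁ C₂ y := by
  unfold stableDensity
  positivity

lemma measurable_stableDensity (α C₁ C₂ : ℝ) : Measurable (stableDensity α C₁ C₂) := by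
  have h : Measurable ((Ioi (0 : ℝ)).indicator fun u : ℝ => u ^ (-α - 1)) :=
    (measurable_id.pow_const _).indicator measurableSet_Ioi
  rw [stableDensity_eq_twoSided]
  exact (h.const_mul C₂).add ((h.comp measurable_neg).const_mul C₁)

lemma integral_stableLevyMeasure (hC₁ : 0 ≤ C₁) (hC₂ : 0 ≤ C₂) (G : ℝ → ℝ) :
    ∫ y, G y ∂(stableLevyMeasure α C₁ C₂) = ∫ y, stableDensity α C₁ C₂ y * G y := by
  rw [stableLevyMeasure, integral_withDensity_eq_integral_toReal_smul
    (measurable_stableDensity α C₁ C₂).ennreal_ofReal (.of_forall fun _ => ENNReal.ofReal_lt_top)]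
  simp_rw [ENNReal.toReal_ofReal (stableDensity_nonneg hC₁ hC₂ _), smul_eq_mul]

lemma integrable_min_stableLevyMeasure (hα₀ : 0 < α) (hα : α < 2) (hC₁ : 0 ≤ C₁) (hC₂ : 0 ≤ C₂) :
    Integrable (fun y => min 1 (y ^ 2)) (stableLevyMeasure α C₁ C₂) := by
  rw [stableLevyMeasure, integrable_withDensity_iff_integrable_smul'
    (measurable_stableDensity α C₁ C₂).ennreal_ofReal (.of_forall fun _ => ENNReal.ofReal_lt_top)]
  simp_rw [ENNReal.toReal_ofReal (stableDensity_nonneg hC₁ hC₂ _), smul_eq_mul]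
  have h := integrableOn_rpow_mul_min hα₀ hα
  rw [stableDensity_eq_twoSided]
  exact integrable_twoSided_mul (G := fun y => min 1 (y ^ 2)) h (by simpa using h) C₁ C₂

lemma gammaConst_stableK0 (hα : 0 < α) (C₁ C₂ : ℝ) :
    gammaConst (stableK0 α C₁ C₂) = (C₁ - C₂) * (stableProfile α 1 + 1 / α) := by
  have hd := hasDerivAt_stableProfile hα one_pos
  rw [Real.one_rpow] at hd
  have h1 : HasDerivAt (stableK0 α C₁ C₂) (C₂ * (-1 / α)) 1 := by
    refine (hd.const_mul C₂).congr_of_eventuallyEq ?_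
    filter_upwards [lt_mem_nhds one_pos] with y hy
    rw [stableK0_eq_twoSided, twoSided_of_pos _ _ _ hy]
  have h2 : HasDerivAt (stableK0 α C₁ C₂) (C₁ * (1 / α)) (-1) := by
    have hn : HasDerivAt (fun y => stableProfile α (-y)) (-(-1 / α)) (-1) := by
      have h := HasDerivAt.scomp (h := fun y : ℝ => -y) (-1) (by rw [neg_neg]; exact hd)
        (hasDerivAt_neg (-1 : ℝ))
      exact h.congr_deriv (by simp)
    refine ((hn.const_mul C₁).congr_deriv (by ring)).congr_of_eventuallyEq ?_
    filter_upwards [gt_mem_nhds (show (-1 : ℝ) < 0 by norm_num)] with y hy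
    rw [stableK0_eq_twoSided, twoSided_of_neg _ _ _ hy]
  rw [gammaConst, h1.deriv, h2.deriv, stableK0_eq_twoSided, twoSided_of_pos _ _ _ one_pos,
    twoSided_of_neg _ _ _ (show (-1 : ℝ) < 0 by norm_num), neg_neg]
  ring

/-- For `α < 1` the small jumps are summable, and `Γ` is the truncated first moment of the
Lévy measure. -/
lemma gammaConst_eq_integral (hα₀ : 0 < α) (hα : α < 1) (C₁ C₂ : ℝ) :
    gammaConst (stableK0 α C₁ C₂) = ∫ y in Icc (-1 : ℝ) 1, y * stableDensity α C₁ C₂ y := by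
  set G : ℝ → ℝ := (Icc (-1 : ℝ) 1).indicator fun y => y with hG
  have e : EqOn (fun u : ℝ => u ^ (-α - 1) * G u) ((Iic (1 : ℝ)).indicator fun u => u ^ (-α))
      (Ioi 0) := by
    intro u hu
    have hu0 : (0 : ℝ) < u := hu
    by_cases h1 : u ≤ 1
    · rw [indicator_of_mem (show u ∈ Iic (1 : ℝ) from h1)]
      simp only [hG]
      rw [indicator_of_mem (show u ∈ Icc (-1 : ℝ) 1 from ⟨by linarith, h1⟩),
        ← Real.rpow_add_one hu0.ne', sub_add_cancel]
    · rw [indicator_of_notMem (show u ∉ Iic (1 : ℝ) from h1)]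
      simp only [hG]
      rw [indicator_of_notMem (fun h => h1 h.2), mul_zero]
  have hodd : ∀ u, G (-u) = -G u := by
    intro u
    by_cases h : u ∈ Icc (-1 : ℝ) 1
    · have h' : -u ∈ Icc (-1 : ℝ) 1 := ⟨by linarith [h.2], by linarith [h.1]⟩
      simp only [hG, indicator_of_mem h, indicator_of_mem h']
    · have h' : -u ∉ Icc (-1 : ℝ) 1 := fun h' => h ⟨by linarith [h'.2], by linarith [h'.1]⟩
      simp only [hG, indicator_of_notMem h, indicator_of_notMem h', neg_zero]
  have hI : IntegrableOn (fun u : ℝ => u ^ (-α)) (Ioc 0 1) :=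
    (intervalIntegrable_iff_integrableOn_Ioc_of_le zero_le_one).1
      (intervalIntegral.intervalIntegrable_rpow' (by linarith))
  have h₂ : IntegrableOn (fun u : ℝ => u ^ (-α - 1) * G u) (Ioi 0) := by
    refine IntegrableOn.congr_fun ?_ e.symm measurableSet_Ioi
    rw [integrableOn_indicator_iff measurableSet_Iic, inter_comm, Ioi_inter_Iic]
    exact hI
  have h₁ : IntegrableOn (fun u : ℝ => u ^ (-α - 1) * G (-u)) (Ioi 0) := by
    simp_rw [hodd, mul_neg]
    exact h₂.neg
  have hJ : ∫ u in Ioi (0 : ℝ), u ^ (-α - 1) * G u = 1 / (1 - α) := by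
    rw [setIntegral_congr_fun measurableSet_Ioi e, setIntegral_indicator measurableSet_Iic,
      Ioi_inter_Iic, ← intervalIntegral.integral_of_le zero_le_one,
      integral_rpow (.inl (by linarith)), Real.one_rpow, Real.zero_rpow (by linarith)]
    ring
  rw [← integral_indicator measurableSet_Icc]
  have e2 : ((Icc (-1 : ℝ) 1).indicator fun y => y * stableDensity α C₁ C₂ y)
      = fun y => twoSided (fun u => u ^ (-α - 1)) C₁ C₂ y * G y := by
    funext y
    rw [indicator_mul_left, stableDensity_eq_twoSided, mul_comm]
  rw [e2, integral_twoSided_mul h₂ h₁]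
  simp_rw [hodd, mul_neg]
  rw [integral_neg, hJ, gammaConst_stableK0 hα₀, stableProfile, if_neg hα.ne, Real.one_rpow]
  have : α - 1 ≠ 0 := by linarith
  have : 1 - α ≠ 0 := by linarith
  field_simp
  ring

lemma locallyIntegrable_stableK0_add_p0 (hα : α < 2) (C₁ C₂ c : ℝ) :
    LocallyIntegrable fun y => stableK0 α C₁ C₂ y + c * p0 y := by
  have h1 : LocallyIntegrable ((Ioi (0 : ℝ)).indicator fun _ => (1 : ℝ)) :=
    (locallyIntegrable_const (1 : ℝ)).indicator measurableSet_Ioi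
  rw [stableK0_eq_twoSided, p0_eq_twoSided]
  exact (locallyIntegrable_twoSided (locallyIntegrable_indicator_stableProfile hα) C₁ C₂).add
    ((locallyIntegrable_twoSided h1 _ _).smul c)

/-- `∫ k₀(u) f''(x + u) du` is the compensated integral of the increments of `f` against the Lévy
density, up to the multiple `Γ` of `f'(x)`. -/
lemma integral_stableK0_mul_deriv_deriv (hα₀ : 0 < α) (hα : α < 2) (hC₁ : 0 ≤ C₁) (hC₂ : 0 ≤ C₂)
    {f : ℝ → ℝ} (hf : ContDiff ℝ 2 f) (hc : HasCompactSupport f) (x : ℝ) :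
    ∫ u, stableK0 α C₁ C₂ u * deriv (deriv f) (x + u)
      = (∫ y, compensatedIncrement f x y ∂(stableLevyMeasure α C₁ C₂))
        + gammaConst (stableK0 α C₁ C₂) * deriv f x := by
  have hF : ContDiff ℝ 2 fun u => f (x + u) := hf.comp (contDiff_const.add contDiff_id)
  have hFc : HasCompactSupport fun u => f (x + u) := hc.comp_homeomorph (Homeomorph.addLeft x)
  have hH : ContDiff ℝ 2 fun u => f (x - u) := hf.comp (contDiff_const.sub contDiff_id)
  have hHc : HasCompactSupport fun u => f (x - u) := hc.comp_homeomorph (Homeomorph.subLeft x)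
  have dF : deriv (fun u => f (x + u)) = fun u => deriv f (x + u) :=
    funext fun u => deriv_comp_const_add f x u
  have dF0 : deriv (fun u => f (x + u)) 0 = deriv f x := by simp [dF]
  have ddF : deriv (deriv fun u => f (x + u)) = fun u => deriv (deriv f) (x + u) := by
    rw [dF]
    exact funext fun u => deriv_comp_const_add (deriv f) x u
  have dH : deriv (fun u => f (x - u)) = fun u => -deriv f (x - u) :=
    funext fun u => deriv_comp_const_sub f x u
  have dH0 : deriv (fun u => f (x - u)) 0 = -deriv f x := by simp [dH]
  have ddH : deriv (deriv fun u => f (x - u)) = fun u => deriv (deriv f) (x - u) := by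
    rw [dH]
    funext u
    rw [deriv.fun_neg, deriv_comp_const_sub (deriv f) x u, neg_neg]
  have kF : ∀ u, compensatedIncrement (fun u => f (x + u)) 0 u = compensatedIncrement f x u := by
    intro u
    rw [compensatedIncrement, compensatedIncrement, dF0, zero_add, add_zero]
  have kH : ∀ u, compensatedIncrement (fun u => f (x - u)) 0 u
      = compensatedIncrement f x (-u) := by
    intro u
    have hiff : -u ∈ Icc (-1 : ℝ) 1 ↔ u ∈ Icc (-1 : ℝ) 1 := by
      simp only [mem_Icc]
      constructor <;> rintro ⟨h1, h2⟩ <;> constructor <;> linarith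
    rw [compensatedIncrement, compensatedIncrement, dH0]
    by_cases h : u ∈ Icc (-1 : ℝ) 1
    · rw [indicator_of_mem h, indicator_of_mem (hiff.2 h), zero_add, sub_zero, sub_eq_add_neg x u]
      ring
    · rw [indicator_of_notMem h, indicator_of_notMem fun h' => h (hiff.1 h'), zero_add, sub_zero,
        sub_eq_add_neg x u]
      ring
  have pF := setIntegral_stableProfile_mul_deriv_deriv hα₀ hα hF hFc
  have pH := setIntegral_stableProfile_mul_deriv_deriv hα₀ hα hH hHc
  have iF := integrableOn_rpow_mul_compensatedIncrement hα₀ hα hF hFc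
  have iH := integrableOn_rpow_mul_compensatedIncrement hα₀ hα hH hHc
  have hl := locallyIntegrable_indicator_stableProfile hα
  have jF := integrableOn_mul_of_hasCompactSupport hl hF.continuous_deriv_deriv hFc.deriv.deriv
  have jH := integrableOn_mul_of_hasCompactSupport hl hH.continuous_deriv_deriv hHc.deriv.deriv
  simp only [kF, ddF, dF0] at pF iF jF
  simp only [kH, ddH, dH0] at pH iH jH
  simp only [sub_eq_add_neg x] at pH jH
  rw [integral_stableLevyMeasure hC₁ hC₂, stableDensity_eq_twoSided,
    integral_twoSided_mul iF iH, gammaConst_stableK0 hα₀, stableK0_eq_twoSided,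
    integral_twoSided_mul (G := fun u => deriv (deriv f) (x + u)) jF jH, pF, pH]
  ring

lemma integral_p0_mul_deriv {g : ℝ → ℝ} (hg : ContDiff ℝ 1 g) (hc : HasCompactSupport g) (x : ℝ) :
    ∫ u, p0 u * deriv g (x + u) = g x := by
  have hF : ContDiff ℝ 1 fun u => g (x + u) := hg.comp (contDiff_const.add contDiff_id)
  have hFc : HasCompactSupport fun u => g (x + u) := hc.comp_homeomorph (Homeomorph.addLeft x)
  have hH : ContDiff ℝ 1 fun u => g (x - u) := hg.comp (contDiff_const.sub contDiff_id)
  have hHc : HasCompactSupport fun u => g (x - u) := hc.comp_homeomorph (Homeomorph.subLeft x)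
  have dF : deriv (fun u => g (x + u)) = fun u => deriv g (x + u) :=
    funext fun u => deriv_comp_const_add g x u
  have dH : deriv (fun u => g (x - u)) = fun u => -deriv g (x - u) :=
    funext fun u => deriv_comp_const_sub g x u
  have iF := (hF.continuous_deriv le_rfl).integrable_of_hasCompactSupport
    (μ := volume) hFc.deriv |>.integrableOn (s := Ioi 0)
  have iH := ((hH.continuous_deriv le_rfl).integrable_of_hasCompactSupport
    (μ := volume) hHc.deriv |>.integrableOn (s := Ioi 0)).neg
  have pF := hFc.integral_Ioi_deriv_eq hF 0
  have pH := hHc.integral_Ioi_deriv_eq hH 0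
  rw [dF] at iF pF
  rw [dH] at iH pH
  rw [integral_neg] at pH
  rw [p0_eq_twoSided, integral_twoSided_mul (G := fun u => deriv g (x + u))
    (by simpa using iF) (by simpa [Pi.neg_def, sub_eq_add_neg] using iH)]
  simp only [one_mul, ← sub_eq_add_neg]
  rw [pF, neg_injective pH, add_zero, sub_zero]
  ring

/-- With the coefficient `γ - Γ` of `p₀`, valid for all `0 < α < 2`. -/
theorem hasConvolutionRepresentation_stable {Ω : Type*} [MeasurableSpace Ω] {P : Measure Ω}
    [IsProbabilityMeasure P] {X : ℝ≥0 → Ω → ℝ} {γ : ℝ} (hα₀ : 0 < α) (hα : α < 2) (hC₁ : 0 ≤ C₁)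
    (hC₂ : 0 ≤ C₂) (hX : IsStableProcess P X α γ C₁ C₂) :
    HasConvolutionRepresentation P X 0
      (fun y => stableK0 α C₁ C₂ y + (γ - gammaConst (stableK0 α C₁ C₂)) * p0 y) := by
  set c := γ - gammaConst (stableK0 α C₁ C₂) with hcdef
  set k : ℝ → ℝ := fun y => stableK0 α C₁ C₂ y + c * p0 y with hk
  have hkl : LocallyIntegrable k := locallyIntegrable_stableK0_add_p0 hα C₁ C₂ c
  have hν := integrable_min_stableLevyMeasure hα₀ hα hC₁ hC₂
  refine ⟨fun M _ => hkl.integrableOn_isCompact isCompact_Icc, fun f hf hc => ⟨fun x => ?_,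
    levyOperatorC0 γ hf hc hν, ?_, fun x => ?_⟩⟩
  · have h := hkl.integrable_smul_right_of_hasCompactSupport
      ((hf.continuous_deriv (by norm_num)).comp (continuous_const_add x))
      (hc.deriv.comp_homeomorph (Homeomorph.addLeft x))
    simpa using h.comp_sub_right x
  · have : SFinite (stableLevyMeasure α C₁ C₂) := by
      unfold stableLevyMeasure
      infer_instance
    exact isGeneratorValue_levyOperatorC0 hX.isLevyProcess hX.hasLevyTriplet hν f hf hc
  · have hconv : convolutionOp 0 k (deriv f)
        = convolution (fun t => k (-t)) (deriv f) (ContinuousLinearMap.mul ℝ ℝ) volume := by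
      funext x
      rw [convolutionOp, convolution_eq_swap]
      simp
    rw [hconv]
    refine (hc.deriv.hasDerivAt_convolution_right _ (locallyIntegrable_comp_neg hkl)
      (hf.deriv' (n := 1)) x).congr_deriv ?_
    rw [convolution_def, ← integral_neg_eq_self]
    simp only [neg_neg, sub_neg_eq_add, ContinuousLinearMap.mul_apply', hk, add_mul, mul_assoc]
    have hsupp : HasCompactSupport fun u => deriv (deriv f) (x + u) :=
      hc.deriv.deriv.comp_homeomorph (Homeomorph.addLeft x)
    have hct : Continuous fun u => deriv (deriv f) (x + u) :=
      hf.continuous_deriv_deriv.comp (continuous_const_add x)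
    have i1 : Integrable fun u => stableK0 α C₁ C₂ u * deriv (deriv f) (x + u) := by
      have h := locallyIntegrable_stableK0_add_p0 hα C₁ C₂ 0
      simp only [zero_mul, add_zero] at h
      exact h.integrable_smul_right_of_hasCompactSupport hct hsupp
    -- With `C₁ = C₂ = 0` the first summand of the kernel vanishes and `p₀` alone remains.
    have i2 : Integrable fun u => p0 u * deriv (deriv f) (x + u) := by
      have h := locallyIntegrable_stableK0_add_p0 (α := 1) one_lt_two 0 0 1
      simp only [stableK0, ite_self, add_zero, mul_zero, one_mul, zero_add] at h
      exact h.integrable_smul_right_of_hasCompactSupport hct hsupp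
    rw [integral_add i1 (i2.const_mul c), integral_const_mul,
      integral_stableK0_mul_deriv_deriv hα₀ hα hC₁ hC₂ hf hc,
      integral_p0_mul_deriv (hf.deriv' (n := 1)) hc.deriv]
    change _ = γ * deriv f x + _
    rw [hcdef]
    ring

end Stable

theorem proposition2p2 {Ω : Type*} [MeasurableSpace Ω] (P : Measure Ω) [IsProbabilityMeasure P]
    (X : ℝ≥0 → Ω → ℝ) (α γ C₁ C₂ : ℝ) (hα₀ : 0 < α) (hα₂ : α < 2) (hC₁ : 0 < C₁) (hC₂ : 0 < C₂)
    (hX : IsStableProcess P X α γ C₁ C₂) :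
    (1 ≤ α →
      HasConvolutionRepresentation P X 0
        (fun y => stableK0 α C₁ C₂ y + (γ - gammaConst (stableK0 α C₁ C₂)) * p0 y)) ∧
    (α < 1 →
      HasConvolutionRepresentation P X 0
        (fun y => stableK0 α C₁ C₂ y + stableDrift α γ C₁ C₂ * p0 y)) := by
  have h := hasConvolutionRepresentation_stable hα₀ hα₂ hC₁.le hC₂.le hX
  refine ⟨fun _ => h, fun hα => ?_⟩
  rw [stableDrift, ← gammaConst_eq_integral hα₀ hα]
  exact h
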